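/- A Steiner triple system STS($v$) is a pair $(V,\mathcal B)$, where $|V|=v$ and $\mathcal B$ is a set of 3-subsets of $V$ (triples) such that any two distinct points of $V$ lie together in exactly one triple. A strict $k$-bicoloring of it is a surjective map from $V$ onto a set of $k$ colors under which every triple receives exactly two colors. The lower (upper) chromatic number $\chi$ ($\bar\chi$) is the least (greatest) $k$ for which a strict $k$-bicoloring exists. Given an STS($v$) $(V,\mathcal B)$ with $V=\{a_1,\dots,a_v\}$, a set $X$ disjoint from $V$ with $|X|=v+1$, and a 1-factorization $\{F_1,\dots,F_v\}$ of the complete graph on $X$, the doubling construction yields the STS($2v+1$) on $V\cup X$ whose triples are those of $\mathcal B$ together with all $\{a_i,x,y\}$ with $\{x,y\}\in F_i$. An extended bicoloring of an STS($2v+1$) so obtained is, for some $k$, a strict $k$-bicoloring of it whose restriction to $V$ is a strict $k$-bicoloring of $(V,\mathcal B)$; that is, the points of $X$ receive only colors already used on $V$. Theorem 10. Let $\Omega=\{27,39,43,55,79,87,91,99,103,111,127,135,151,159,175\}$. For every $w\in\Omega$ there exists an STS($w$) which is obtained by the doubling construction from an STS($\frac{w-1}{2}$) and has an extended bicoloring,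 and for which $\chi\neq\bar\chi$. -/

import Mathlib

/-- A Steiner triple system on the point set `V`: a collection of 3-subsets (triples) of `V` such
that any two distinct points lie together in exactly one triple.  It is an STS(v) if `V` has `v`
elements. -/
structure SteinerTripleSystem (V : Type) where
  /-- the triples -/
  triples : Set (Finset V)
  card_eq_three : ∀ B ∈ triples, B.card = 3
  existsUnique_triple : ∀ x y : V, x ≠ y → ∃! B : Finset V, B ∈ triples ∧ x ∈ B ∧ y ∈ B

/-- A 1-factorization of the complete graph on `X`, with its 1-factors (perfect matchings) indexed
by `ι`: every edge of the complete graph lies in exactly one of the 1-factors. -/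
structure OneFactorization (ι X : Type) where
  /-- the 1-factors -/
  factor : ι → (⊤ : SimpleGraph X).Subgraph
  isPerfectMatching : ∀ i, (factor i).IsPerfectMatching
  existsUnique_factor : ∀ x y : X, x ≠ y → ∃! i, (factor i).Adj x y

namespace SteinerTripleSystem

variable {V X W C : Type}

/-- `φ` is a bicoloring of `S`: every triple receives exactly two colors. -/
def IsBicoloring [DecidableEq C] (S : SteinerTripleSystem V) (φ : V → C) : Prop :=
  ∀ B ∈ S.triples, (B.image φ).card = 2

/-- `φ` is a strict `k`-bicoloring of `S`: a bicoloring in which exactly `k` colors, named by the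
elements of `Fin k`, are used. -/
def IsStrictBicoloring (S : SteinerTripleSystem V) {k : ℕ} (φ : V → Fin k) : Prop :=
  S.IsBicoloring φ ∧ Function.Surjective φ

/-- The numbers `k` such that `S` has a strict `k`-bicoloring. -/
def bicoloringNumbers (S : SteinerTripleSystem V) : Set ℕ :=
  {k | ∃ φ : V → Fin k, S.IsStrictBicoloring φ}

/-- `m` is the lower chromatic number of `S`. -/
def IsLowerChromaticNumber (S : SteinerTripleSystem V) (m : ℕ) : Prop :=
  IsLeast S.bicoloringNumbers m

/-- `m` is the upper chromatic number of `S`. -/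
def IsUpperChromaticNumber (S : SteinerTripleSystem V) (m : ℕ) : Prop :=
  IsGreatest S.bicoloringNumbers m

/-- `T` is the system obtained by the doubling construction from `S` and the 1-factorization `F` of
the complete graph on `X`, when the disjoint union of `V` and `X` is identified with the point set
of `T` by `e`: the triples of `T` are those of `S` and the sets `{a, x, y}` where `a` is a point of
`S` and `{x, y}` is an edge of the 1-factor of `a`. -/
def IsDoubling (T : SteinerTripleSystem W) (S : SteinerTripleSystem V) (F : OneFactorization V X)
    (e : V ⊕ X ≃ W) : Prop :=
  ∀ B : Finset W, B ∈ T.triples ↔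
    (∃ A ∈ S.triples, (B : Set W) = (fun a => e (Sum.inl a)) '' (A : Set V)) ∨
    (∃ (a : V) (x y : X), (F.factor a).Adj x y ∧
      (B : Set W) = {e (Sum.inl a), e (Sum.inr x), e (Sum.inr y)})

/-- `T` has an extended bicoloring: `T` is obtained by the doubling construction from an STS(v) and
a 1-factorization of the complete graph on `v + 1` vertices, and for some `k` there is a strict
`k`-bicoloring of `T` whose restriction to the STS(v) is a strict `k`-bicoloring of the STS(v), so
that the new points receive no color which is not already used on the STS(v). -/
def HasExtendedBicoloring (T : SteinerTripleSystem W) : Prop :=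
  ∃ (v : ℕ) (S : SteinerTripleSystem (Fin v)) (F : OneFactorization (Fin v) (Fin (v + 1)))
    (e : Fin v ⊕ Fin (v + 1) ≃ W), T.IsDoubling S F e ∧
    ∃ (k : ℕ) (φ : Fin v → Fin k) (ψ : W → Fin k),
      S.IsStrictBicoloring φ ∧ T.IsStrictBicoloring ψ ∧ ∀ a : Fin v, ψ (e (Sum.inl a)) = φ a

end SteinerTripleSystem

/-! Suppose the double of an STS(v) has an extended bicoloring with k colors. Keeping the coloring
on `V` and giving all of `X` one new color is also a bicoloring: a triple lies inside `V` or has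
exactly two points in `X`. So k and k + 1 are both bicoloring numbers, and the chromatic numbers
differ (`exists_hasExtendedBicoloring`).

The property propagates. Let the double, with its (k + 1)-coloring, be the new base, and let two
copies of `X` be the new points, one wholly in the new color and the other with the old colors of
`X`. Edges inside a copy keep their old factors. Cross edges are split into factors indexed by the
points of `X`, using the addition table of an abelian group on `X`. Every resulting triple is
two-colored (`BicoloredDoubling.double`), so a good v yields 2v + 1.

It remains to exhibit good systems for v = 13, 19, 21, 25, 31, 33, 37, 45, 49. These are explicit
numerical tables, checked by kernel computation and made sound by `hasBicoloredDoubling_of_check`.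
-/

/-! ### Two-colored triples of colors. -/

/-- Three colors of which exactly two are distinct. -/
def TwoColored {C : Type} (a b c : C) : Prop :=
  (a = b ∨ b = c ∨ a = c) ∧ ¬(a = b ∧ b = c)

instance {C : Type} [DecidableEq C] (a b c : C) : Decidable (TwoColored a b c) :=
  inferInstanceAs (Decidable ((a = b ∨ b = c ∨ a = c) ∧ ¬(a = b ∧ b = c)))

namespace TwoColored

variable {C D : Type}

theorem map_iff {f : C → D} (hf : Function.Injective f) {a b c : C} :
    TwoColored (f a) (f b) (f c) ↔ TwoColored a b c := by
  simp only [TwoColored, hf.eq_iff]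

theorem rotate {a b c : C} (h : TwoColored a b c) : TwoColored b c a := by
  unfold TwoColored at *; grind

theorem swap {a b c : C} (h : TwoColored a b c) : TwoColored b a c := by
  unfold TwoColored at *; grind

theorem card_image {V : Type} [DecidableEq V] [DecidableEq C] (φ : V → C) {x y z : V}
    (h : TwoColored (φ x) (φ y) (φ z)) : (({x, y, z} : Finset V).image φ).card = 2 := by
  rw [Finset.image_insert, Finset.image_insert, Finset.image_singleton]
  obtain ⟨h1 | h1 | h1, h2⟩ := h
  · rw [h1, Finset.insert_eq_of_mem (Finset.mem_insert_self _ _), Finset.card_pair]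
    grind
  · rw [h1, Finset.pair_eq_singleton, Finset.card_pair]
    grind
  · rw [h1, Finset.pair_comm, Finset.insert_eq_of_mem (Finset.mem_insert_self _ _),
      Finset.card_pair]
    grind

end TwoColored

/-! ### Triple systems from totally symmetric operations, and chromatic numbers. -/

namespace SteinerTripleSystem

/-- The Steiner triple system of an idempotent totally symmetric operation, whose triples are the
sets `{x, y, t x y}` with `x ≠ y`. -/
def ofThird {V : Type} [DecidableEq V] (t : V → V → V) (comm : ∀ x y, t x y = t y x)
    (self : ∀ x, t x x = x) (third : ∀ x y, t x (t x y) = y) : SteinerTripleSystem V where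
  triples := {B | ∃ x y, x ≠ y ∧ B = {x, y, t x y}}
  card_eq_three := by
    rintro B ⟨x, y, hxy, rfl⟩
    have h1 : x ≠ t x y := fun h => hxy (by have := third x y; rwa [← h, self] at this)
    have h2 : y ≠ t x y := fun h => hxy (by
      have := third y x; rw [comm y x, ← h, self] at this; exact this.symm)
    exact Finset.card_eq_three.2 ⟨x, y, t x y, hxy, h1, h2, rfl⟩
  existsUnique_triple := by
    intro x y hxy
    refine ⟨{x, y, t x y}, ⟨⟨x, y, hxy, rfl⟩, by simp, by simp⟩, ?_⟩
    rintro B ⟨⟨a, b, hab, rfl⟩, hx, hy⟩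
    -- These identities give the third point of any two among `a`, `b`, `t a b`, which settles every
    -- placement of `x` and `y` in the triple.
    have h1 := third a b
    have h2 : t b (t a b) = a := by rw [comm a b]; exact third b a
    have h3 := comm a b
    have h4 := comm a (t a b)
    have h5 := comm b (t a b)
    simp only [Finset.mem_insert, Finset.mem_singleton] at hx hy
    ext z
    simp only [Finset.mem_insert, Finset.mem_singleton]
    rcases hx with rfl | rfl | rfl <;> rcases hy with rfl | rfl | rfl <;> grind

theorem isBicoloring_ofThird {V C : Type} [DecidableEq V] [DecidableEq C] {t : V → V → V}
    {comm : ∀ x y, t x y = t y x} {self : ∀ x, t x x = x} {third : ∀ x y, t x (t x y) = y}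
    {φ : V → C} (h : ∀ x y, x ≠ y → TwoColored (φ x) (φ y) (φ (t x y))) :
    (ofThird t comm self third).IsBicoloring φ := by
  rintro B ⟨x, y, hxy, rfl⟩
  exact (h x y hxy).card_image φ

theorem le_card_of_mem_bicoloringNumbers {V : Type} [Fintype V] {S : SteinerTripleSystem V} {k : ℕ}
    (h : k ∈ S.bicoloringNumbers) : k ≤ Fintype.card V := by
  obtain ⟨φ, -, hφ⟩ := h
  simpa using Fintype.card_le_of_surjective φ hφ

/-- A system with strict bicolorings in two different numbers of colors has distinct lower and
upper chromatic numbers. -/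
theorem exists_lower_ne_upper {V : Type} [Fintype V] {S : SteinerTripleSystem V} {k l : ℕ}
    (hk : k ∈ S.bicoloringNumbers) (hl : l ∈ S.bicoloringNumbers) (hkl : k < l) :
    ∃ m n : ℕ, S.IsLowerChromaticNumber m ∧ S.IsUpperChromaticNumber n ∧ m ≠ n := by
  have hb : BddAbove S.bicoloringNumbers :=
    ⟨Fintype.card V, fun _ h => le_card_of_mem_bicoloringNumbers h⟩
  refine ⟨sInf S.bicoloringNumbers, sSup S.bicoloringNumbers,
    ⟨Nat.sInf_mem ⟨k, hk⟩, fun _ h => Nat.sInf_le h⟩,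
    ⟨Nat.sSup_mem ⟨k, hk⟩ hb, fun _ h => le_csSup hb h⟩, ?_⟩
  have h1 := Nat.sInf_le hk
  have h2 := le_csSup hb hl
  omega

end SteinerTripleSystem

/-! ### Bicolored doublings and their recursive doubling. -/

/-- A Steiner triple system on `V` (given by its third-point operation) with a 1-factorization of
the complete graph on `X` indexed by `V` (given by the index of the factor of an edge and by the
neighbor of a vertex in a factor), and colorings of `V` and `X` that together form a bicoloring of
the resulting double system in which every color occurs on `V`. -/
structure BicoloredDoubling (V X C : Type) where
  third : V → V → V
  edge : X → X → V
  partner : V → X → X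
  colV : V → C
  colX : X → C
  third_comm : ∀ a b, third a b = third b a
  third_self : ∀ a, third a a = a
  third_third : ∀ a b, third a (third a b) = b
  edge_comm : ∀ x y, edge x y = edge y x
  partner_ne : ∀ a x, partner a x ≠ x
  edge_partner : ∀ a x, edge x (partner a x) = a
  partner_edge : ∀ x y, x ≠ y → partner (edge x y) x = y
  twoColored_third : ∀ a b, a ≠ b → TwoColored (colV a) (colV b) (colV (third a b))
  twoColored_edge : ∀ x y, x ≠ y → TwoColored (colV (edge x y)) (colX x) (colX y)
  colV_surjective : Function.Surjective colV

namespace BicoloredDoubling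

open SteinerTripleSystem

variable {V X C V' X' C' : Type}

theorem partner_partner (D : BicoloredDoubling V X C) (a : V) (x : X) :
    D.partner a (D.partner a x) = x := by
  have h := D.partner_edge _ _ (D.partner_ne a x)
  rwa [D.edge_comm, D.edge_partner] at h

/-- Renaming of points and colors. -/
def map (D : BicoloredDoubling V X C) (e : V ≃ V') (f : X ≃ X') (g : C ≃ C') :
    BicoloredDoubling V' X' C' where
  third a b := e (D.third (e.symm a) (e.symm b))
  edge x y := e (D.edge (f.symm x) (f.symm y))
  partner a x := f (D.partner (e.symm a) (f.symm x))
  colV a := g (D.colV (e.symm a))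
  colX x := g (D.colX (f.symm x))
  third_comm a b := by rw [D.third_comm]
  third_self a := by simp [D.third_self]
  third_third a b := by simp [D.third_third]
  edge_comm x y := by rw [D.edge_comm]
  partner_ne a x h := D.partner_ne (e.symm a) (f.symm x) (f.injective (by simpa using h))
  edge_partner a x := by simp [D.edge_partner]
  partner_edge x y h := by simp [D.partner_edge (f.symm x) (f.symm y) (by simpa using h)]
  twoColored_third a b h := by
    simpa [TwoColored.map_iff g.injective] using
      D.twoColored_third (e.symm a) (e.symm b) (by simpa using h)
  twoColored_edge x y h := by
    simpa [TwoColored.map_iff g.injective] using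
      D.twoColored_edge (f.symm x) (f.symm y) (by simpa using h)
  colV_surjective := g.surjective.comp (D.colV_surjective.comp e.symm.surjective)

/-- The third-point operation of the double system. -/
def sumThird [DecidableEq X] (D : BicoloredDoubling V X C) : V ⊕ X → V ⊕ X → V ⊕ X
  | .inl a, .inl b => .inl (D.third a b)
  | .inl a, .inr x => .inr (D.partner a x)
  | .inr x, .inl a => .inr (D.partner a x)
  -- The diagonal is idempotent by fiat; `edge x x` carries no information.
  | .inr x, .inr y => if x = y then .inr x else .inl (D.edge x y)

/-- The coloring of the points of the double system in which all new points receive one new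
color. -/
def newColor (D : BicoloredDoubling V X C) : V ⊕ X → Option C :=
  Sum.elim (fun a => some (D.colV a)) fun _ => none

theorem newColor_surjective [Nonempty X] (D : BicoloredDoubling V X C) :
    Function.Surjective D.newColor := by
  rintro (_ | c)
  · exact ⟨.inr (Classical.arbitrary X), rfl⟩
  · obtain ⟨a, rfl⟩ := D.colV_surjective c
    exact ⟨.inl a, rfl⟩

section sumThird

variable [DecidableEq X] (D : BicoloredDoubling V X C)

theorem sumThird_comm (p q : V ⊕ X) : D.sumThird p q = D.sumThird q p := by
  rcases p with a | x <;> rcases q with b | y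
  · simp [sumThird, D.third_comm a b]
  · rfl
  · rfl
  · by_cases h : x = y
    · rw [h]
    · simp [sumThird, h, Ne.symm h, D.edge_comm x y]

theorem sumThird_self (p : V ⊕ X) : D.sumThird p p = p := by
  rcases p with a | x
  · simp [sumThird, D.third_self]
  · simp [sumThird]

theorem sumThird_sumThird (p q : V ⊕ X) : D.sumThird p (D.sumThird p q) = q := by
  rcases p with a | x <;> rcases q with b | y
  · simp [sumThird, D.third_third]
  · simp [sumThird, D.partner_partner]
  · simp [sumThird, (D.partner_ne b x).symm, D.edge_partner]
  · by_cases h : x = y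
    · simp [sumThird, h]
    · simp [sumThird, h, D.partner_edge x y h]

/-- The extended bicoloring of the double system. -/
theorem twoColored_elim (p q : V ⊕ X) (h : p ≠ q) :
    TwoColored (Sum.elim D.colV D.colX p) (Sum.elim D.colV D.colX q)
      (Sum.elim D.colV D.colX (D.sumThird p q)) := by
  -- A mixed pair lies in the triple coming from the edge from `x` to its partner in the factor of
  -- `a`.
  have key (a : V) (x : X) :
      TwoColored (D.colV a) (D.colX x) (D.colX (D.partner a x)) := by
    simpa [D.edge_partner] using D.twoColored_edge x _ (D.partner_ne a x).symm
  rcases p with a | x <;> rcases q with b | y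
  · exact D.twoColored_third a b (by simpa using h)
  · exact key a y
  · exact (key b x).swap
  · have h' : x ≠ y := by simpa using h
    simpa [sumThird, h'] using (D.twoColored_edge x y h').rotate

/-- A triple meeting `X` has two points there, both in the new color, and one old point in an old
color; a triple inside `V` keeps its two colors. -/
theorem twoColored_newColor (p q : V ⊕ X) (h : p ≠ q) :
    TwoColored (D.newColor p) (D.newColor q) (D.newColor (D.sumThird p q)) := by
  rcases p with a | x <;> rcases q with b | y
  · exact (TwoColored.map_iff (Option.some_injective C)).2
      (D.twoColored_third a b (by simpa using h))
  · simp [TwoColored, newColor, sumThird]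
  · simp [TwoColored, newColor, sumThird]
  · have h' : x ≠ y := by simpa using h
    simp [TwoColored, newColor, sumThird, h']

/-- The double system, in the coloring where all points of `X` receive one new color, again has an
extended bicoloring: one copy of `X` takes the new color and the other one its old colors. -/
def double [Nonempty X] [AddCommGroup X] : BicoloredDoubling (V ⊕ X) (X ⊕ X) (Option C) where
  third := D.sumThird
  edge
    | .inl x, .inl y => .inl (D.edge x y)
    | .inr x, .inr y => .inl (D.edge x y)
    -- The sum is a Latin square: for each `g`, `x ↦ g - x` matches one copy of `X` with the other.
    -- Commutativity makes the index independent of the order of the endpoints. The index is a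
    -- former new point, so it has the new color, as does the endpoint in the first copy; the other
    -- endpoint has an old color.
    | .inl x, .inr y => .inr (x + y)
    | .inr x, .inl y => .inr (x + y)
  partner
    | .inl a, .inl x => .inl (D.partner a x)
    | .inl a, .inr x => .inr (D.partner a x)
    | .inr g, .inl x => .inr (g - x)
    | .inr g, .inr x => .inl (g - x)
  colV := D.newColor
  colX := Sum.elim (fun _ => none) fun x => some (D.colX x)
  third_comm := D.sumThird_comm
  third_self := D.sumThird_self
  third_third := D.sumThird_sumThird
  edge_comm := by rintro (x | x) (y | y) <;> simp [D.edge_comm x y, add_comm x y]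
  partner_ne := by rintro (a | g) (x | x) <;> simp [D.partner_ne]
  edge_partner := by rintro (a | g) (x | x) <;> simp [D.edge_partner]
  partner_edge := by
    rintro (x | x) (y | y) h
    · simpa using D.partner_edge x y (by simpa using h)
    · simp
    · simp
    · simpa using D.partner_edge x y (by simpa using h)
  twoColored_third := D.twoColored_newColor
  twoColored_edge := by
    rintro (x | x) (y | y) h
    · simp [TwoColored, newColor]
    · simp [TwoColored, newColor]
    · simp [TwoColored, newColor]
    · exact (TwoColored.map_iff (Option.some_injective C)).2
        (D.twoColored_edge x y (by simpa using h))
  colV_surjective := D.newColor_surjective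

end sumThird

/-! ### From operations back to 1-factorizations and triple systems. -/

/-- The 1-factorization of a `BicoloredDoubling`. -/
def oneFactorization (D : BicoloredDoubling V X C) : OneFactorization V X where
  factor a :=
    { verts := Set.univ
      Adj := fun x y => x ≠ y ∧ D.edge x y = a
      adj_sub := fun h => h.1
      edge_vert := fun _ => Set.mem_univ _
      symm := ⟨fun x y h => ⟨h.1.symm, D.edge_comm x y ▸ h.2⟩⟩ }
  isPerfectMatching a := by
    refine ⟨fun x _ => ⟨D.partner a x, ⟨(D.partner_ne a x).symm, D.edge_partner a x⟩, ?_⟩,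
      fun x => Set.mem_univ x⟩
    rintro y ⟨hxy, rfl⟩
    exact (D.partner_edge x y hxy).symm
  existsUnique_factor x y h := ⟨D.edge x y, ⟨h, rfl⟩, fun _ ha => ha.2.symm⟩

/-- The Steiner triple system on `V`. -/
def base [DecidableEq V] (D : BicoloredDoubling V X C) : SteinerTripleSystem V :=
  ofThird D.third D.third_comm D.third_self D.third_third

/-- The double system, with its points renamed by `e`. -/
def total {W : Type} [DecidableEq X] [DecidableEq W] (D : BicoloredDoubling V X C)
    (e : V ⊕ X ≃ W) : SteinerTripleSystem W :=
  ofThird (fun p q => e (D.sumThird (e.symm p) (e.symm q)))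
    (fun p q => by rw [D.sumThird_comm]) (fun p => by simp [D.sumThird_self])
    (fun p q => by simp [D.sumThird_sumThird])

section total

variable {W : Type} [DecidableEq V] [DecidableEq X] [DecidableEq W]
  (D : BicoloredDoubling V X C) (e : V ⊕ X ≃ W)

/-- Any pair containing a new point generates a triple of the second kind; conversely such a triple
is generated by its two new points. -/
theorem isDoubling : (D.total e).IsDoubling D.base D.oneFactorization e := by
  intro B
  constructor
  · rintro ⟨p, q, hpq, rfl⟩
    obtain ⟨p, rfl⟩ := e.surjective p
    obtain ⟨q, rfl⟩ := e.surjective q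
    have hpq' : p ≠ q := fun h => hpq (h ▸ rfl)
    rcases p with a | x <;> rcases q with b | y
    · refine Or.inl ⟨_, ⟨a, b, by simpa using hpq', rfl⟩, ?_⟩
      simp [sumThird, Set.image_insert_eq]
    · refine Or.inr ⟨a, y, D.partner a y, ⟨(D.partner_ne a y).symm, D.edge_partner a y⟩, ?_⟩
      simp [sumThird]
    · refine Or.inr ⟨b, x, D.partner b x, ⟨(D.partner_ne b x).symm, D.edge_partner b x⟩, ?_⟩
      simp [sumThird, Set.insert_comm]
    · have h' : x ≠ y := by simpa using hpq'
      refine Or.inr ⟨D.edge x y, x, y, ⟨h', rfl⟩, ?_⟩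
      ext w
      simp only [sumThird, Equiv.symm_apply_apply, h', if_false, Finset.coe_insert,
        Finset.coe_singleton, Set.mem_insert_iff, Set.mem_singleton_iff]
      tauto
  · rintro (⟨A, ⟨a, b, hab, rfl⟩, hB⟩ | ⟨a, x, y, ⟨hxy, rfl⟩, hB⟩)
    · refine ⟨e (.inl a), e (.inl b), by simpa using hab, ?_⟩
      apply Finset.coe_injective
      rw [hB]
      simp [sumThird, Set.image_insert_eq]
    · refine ⟨e (.inr x), e (.inr y), by simpa using hxy, ?_⟩
      apply Finset.coe_injective
      rw [hB]
      ext w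
      simp only [sumThird, Equiv.symm_apply_apply, hxy, if_false, Finset.coe_insert,
        Finset.coe_singleton, Set.mem_insert_iff, Set.mem_singleton_iff]
      tauto

end total

/-- The double system has an extended bicoloring, and distinct chromatic numbers because a new
color may instead be given to all new points. -/
theorem exists_hasExtendedBicoloring {v k : ℕ}
    (D : BicoloredDoubling (Fin v) (Fin (v + 1)) (Fin k)) :
    ∃ T : SteinerTripleSystem (Fin (2 * v + 1)), T.HasExtendedBicoloring ∧
      ∃ m n : ℕ, T.IsLowerChromaticNumber m ∧ T.IsUpperChromaticNumber n ∧ m ≠ n := by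
  let e : Fin v ⊕ Fin (v + 1) ≃ Fin (2 * v + 1) :=
    finSumFinEquiv.trans (finCongr (by omega))
  have hφ : D.base.IsStrictBicoloring D.colV :=
    ⟨isBicoloring_ofThird D.twoColored_third, D.colV_surjective⟩
  have hψ : (D.total e).IsStrictBicoloring fun w => Sum.elim D.colV D.colX (e.symm w) := by
    refine ⟨isBicoloring_ofThird fun p q h => ?_, fun c => ?_⟩
    · simpa using D.twoColored_elim (e.symm p) (e.symm q) (by simpa using h)
    · obtain ⟨a, rfl⟩ := D.colV_surjective c
      exact ⟨e (.inl a), by simp⟩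
  -- The second bicoloring, with `k + 1` colors.
  have hnew : (D.total e).IsStrictBicoloring
      fun w => (finSuccEquiv k).symm (D.newColor (e.symm w)) := by
    refine ⟨isBicoloring_ofThird fun p q h => ?_, ?_⟩
    · simpa [TwoColored.map_iff (finSuccEquiv k).symm.injective] using
        D.twoColored_newColor (e.symm p) (e.symm q) (by simpa using h)
    · exact (finSuccEquiv k).symm.surjective.comp
        (D.newColor_surjective.comp e.symm.surjective)
  exact ⟨D.total e, ⟨v, D.base, D.oneFactorization, e, D.isDoubling e, k, _, _, hφ, hψ,
    fun a => by simp⟩, exists_lower_ne_upper ⟨_, hψ⟩ ⟨_, hnew⟩ k.lt_succ_self⟩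

end BicoloredDoubling

/-- There is a bicolored STS(`v`) with an extended bicoloring of one of its doubles. -/
def HasBicoloredDoubling (v : ℕ) : Prop :=
  ∃ k : ℕ, Nonempty (BicoloredDoubling (Fin v) (Fin (v + 1)) (Fin k))

/-- The cyclic group on `Fin (v + 1)` supplies the Latin square; the number of colors grows by one.
-/
theorem HasBicoloredDoubling.double {v : ℕ} (h : HasBicoloredDoubling v) :
    HasBicoloredDoubling (2 * v + 1) := by
  obtain ⟨k, ⟨D⟩⟩ := h
  exact ⟨k + 1, ⟨D.double.map (finSumFinEquiv.trans (finCongr (by omega)))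
    (finSumFinEquiv.trans (finCongr (by omega))) (finSuccEquiv k).symm⟩⟩

/-! ### Numerical tables and their verification. -/

/-- Entry `(i, j)` of the symmetric table whose row `i` is given by the base 64 digits of `r[i]`,
in the columns `j < i`. -/
def symmEntry (r : List ℕ) (i j : ℕ) : ℕ :=
  -- Base 64 suffices, since all entries used are below 49. The value at `i = j` is meaningless and
  -- never relied on.
  if j < i then r.getD i 0 / 64 ^ j % 64 else r.getD j 0 / 64 ^ i % 64

theorem symmEntry_comm (r : List ℕ) (i j : ℕ) : symmEntry r i j = symmEntry r j i := by
  unfold symmEntry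
  rcases lt_trichotomy i j with h | rfl | h
  · rw [if_neg h.not_gt, if_pos h]
  · rfl
  · rw [if_pos h, if_neg h.not_gt]

/-- The idempotent symmetric operation of a table. -/
def tableThird (r : List ℕ) (i j : ℕ) : ℕ :=
  if i = j then i else symmEntry r i j

/-- The coloring with intervals as color classes, separated by the bounds `c`. -/
def intervalColor (c : List ℕ) (i : ℕ) : ℕ :=
  c.countP (· ≤ i)

/-- The table `r` describes a Steiner triple system on `v` points with the strict bicoloring
`intervalColor c`. -/
def checkSystem (v : ℕ) (c r : List ℕ) : Bool :=
  ((List.range v).all fun i => (List.range v).all fun j => i == j ||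
    (let t := tableThird r i j;
      t < v && tableThird r i t == j &&
        decide (TwoColored (intervalColor c i) (intervalColor c j) (intervalColor c t)))) &&
  (List.range (c.length + 1)).all fun k => (List.range v).any fun i => intervalColor c i == k

/-- The table `s` describes a 1-factorization of the complete graph on `v + 1` vertices whose
coloring `intervalColor d` is compatible with the coloring `intervalColor c` of its factors. -/
def checkFactorization (v : ℕ) (c d s : List ℕ) : Bool :=
  (List.range (v + 1)).all fun x =>
    ((List.range (v + 1)).all fun y => x == y ||
      (let a := symmEntry s x y;
        a < v && decide (TwoColored (intervalColor c a) (intervalColor d x) (intervalColor d y)))) &&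
    -- The bit mask of the factors seen at `x`; it is full exactly when each of the `v` factors
    -- occurs there.
    (List.range (v + 1)).foldr
      (fun y m => if x = y then m else 2 ^ symmEntry s x y ||| m) 0 == 2 ^ v - 1

theorem exists_of_testBit_foldr_or {α : Type} {p : α → Prop} [DecidablePred p] {f : α → ℕ} {a : ℕ}
    (l : List α)
    (h : (l.foldr (fun y m => if p y then m else 2 ^ f y ||| m) 0).testBit a = true) :
    ∃ y ∈ l, ¬p y ∧ f y = a := by
  induction l with
  | nil => simp at h
  | cons y l ih =>
    rw [List.foldr_cons] at h
    split_ifs at h with hy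
    · obtain ⟨z, hz, h⟩ := ih h
      exact ⟨z, List.mem_cons_of_mem _ hz, h⟩
    · rw [Nat.testBit_or, Bool.or_eq_true, Nat.testBit_two_pow] at h
      rcases h with h | h
      · exact ⟨y, List.mem_cons_self, hy, by simpa using h⟩
      · obtain ⟨z, hz, h⟩ := ih h
        exact ⟨z, List.mem_cons_of_mem _ hz, h⟩

/-- Symmetry is built into the tables. For the factorization only surjectivity of the edge indices
at each vertex is tested; with `v` neighbors and `v` factors, counting gives bijectivity, hence
perfect matchings. The bounds `c` and `d` need equal length so that both colorings use the same
color set. -/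
theorem hasBicoloredDoubling_of_check {v : ℕ} [NeZero v] (c r d s : List ℕ)
    (hd : d.length = c.length) (hr : checkSystem v c r = true)
    (hs : checkFactorization v c d s = true) : HasBicoloredDoubling v := by
  simp only [checkSystem, Bool.and_eq_true, Bool.or_eq_true, List.all_eq_true, List.any_eq_true,
    List.mem_range, beq_iff_eq, decide_eq_true_eq] at hr
  simp only [checkFactorization, Bool.and_eq_true, Bool.or_eq_true, List.all_eq_true,
    List.mem_range, beq_iff_eq, decide_eq_true_eq] at hs
  obtain ⟨hr, hsurj⟩ := hr
  have hr' (i j : Fin v) (h : i ≠ j) := (hr i i.2 j j.2).resolve_left (Fin.val_ne_of_ne h)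
  have hs' (x y : Fin (v + 1)) (h : x ≠ y) :=
    ((hs x x.2).1 y y.2).resolve_left (Fin.val_ne_of_ne h)
  let third (i j : Fin v) : Fin v := ⟨tableThird r i j, by
    by_cases h : i = j
    · simp [tableThird, h]
    · exact (hr' i j h).1.1⟩
  let edge (x y : Fin (v + 1)) : Fin v :=
    -- The value `0` on the diagonal is a dummy.
    if h : x = y then 0 else ⟨symmEntry s x y, (hs' x y h).1⟩
  have val_edge (x y : Fin (v + 1)) (h : x ≠ y) : (edge x y : ℕ) = symmEntry s x y := by
    simp [edge, h]
  have hlt {b : List ℕ} (hb : b.length = c.length) (i : ℕ) :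
      intervalColor b i < c.length + 1 := by
    rw [← hb]
    exact Nat.lt_succ_of_le List.countP_le_length
  have hsurjX (x : Fin (v + 1)) (a : Fin v) : ∃ y : {y // y ≠ x}, edge x y = a := by
    -- All bits below `v` of the full mask are set, so the factor `a` was contributed by some
    -- neighbor of `x`.
    have h : (2 ^ v - 1).testBit (a : ℕ) = true := by simp
    rw [← (hs x x.2).2] at h
    obtain ⟨y, hy, hxy, h⟩ := exists_of_testBit_foldr_or _ h
    have hne : (⟨y, List.mem_range.1 hy⟩ : Fin (v + 1)) ≠ x := fun e => hxy (by rw [← e])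
    exact ⟨⟨_, hne⟩, Fin.ext ((val_edge _ _ hne.symm).trans h)⟩
  have hinjX (x : Fin (v + 1)) : Function.Injective fun y : {y // y ≠ x} => edge x y :=
    ((Fintype.bijective_iff_surjective_and_card _).2 ⟨hsurjX x, by simp⟩).1
  choose partner hpartner using hsurjX
  exact ⟨c.length + 1, ⟨{
    third := third
    edge := edge
    partner := fun a x => partner x a
    colV := fun a => ⟨intervalColor c a, hlt rfl a⟩
    colX := fun x => ⟨intervalColor d x, hlt hd x⟩
    third_comm := fun i j => Fin.ext (by
      by_cases h : i = j
      · rw [h]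
      · simp [third, tableThird, Fin.val_ne_of_ne h, (Fin.val_ne_of_ne h).symm,
          symmEntry_comm r i j])
    third_self := fun i => Fin.ext (by simp [third, tableThird])
    third_third := fun i j => Fin.ext (by
      by_cases h : i = j
      · simp [third, tableThird, h]
      · exact (hr' i j h).1.2)
    edge_comm := fun x y => Fin.ext (by
      by_cases h : x = y
      · rw [h]
      · rw [val_edge x y h, val_edge y x (Ne.symm h), symmEntry_comm])
    partner_ne := fun a x => (partner x a).2
    edge_partner := fun a x => hpartner x a
    partner_edge := fun x y h =>
      -- At `x`, both the chosen partner and `y` lie along the same factor.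
      congrArg Subtype.val (@hinjX x (partner x (edge x y)) ⟨y, Ne.symm h⟩ (hpartner x _))
    twoColored_third := fun i j h =>
      (TwoColored.map_iff Fin.val_injective).1 (hr' i j h).2
    twoColored_edge := fun x y h =>
      (TwoColored.map_iff Fin.val_injective).1 (by
        simpa only [val_edge x y h] using (hs' x y h).2)
    colV_surjective := fun k => by
      obtain ⟨i, hi, hk⟩ := hsurj k k.2
      exact ⟨⟨i, hi⟩, Fin.ext hk⟩ }⟩⟩

/-! ### The starting systems. -/

/-- The lists are, in order, the color bounds on `V`, the third points, the color bounds on `X` and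
the factor indices. Here the color classes have sizes 6, 5, 2 on `V` and 6, 4, 4 on `X`. -/
theorem hasBicoloredDoubling_13 : HasBicoloredDoubling 13 :=
  hasBicoloredDoubling_of_check [6, 11]
    [0, 7, 651, 25292, 2146890, 186422022, 117977605, 278201139201, 8875601326473, 49205312246024,
     55504111476674692, 7047047790920466626, 598477488106802004291]
    [6, 10]
    [0, 10, 396, 33545, 2912774, 169390664, 1227375043, 142809538753, 48725397864519,
     3395299473396034, 145844445023310091, 3641468724709434052, 528238512484394217477,
     42583266709739500490880]
    rfl (by decide +kernel) (by decide +kernel)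

theorem hasBicoloredDoubling_19 : HasBicoloredDoubling 19 :=
  hasBicoloredDoubling_of_check [9, 15]
    [0, 9, 977, 54346, 2417488, 170984590, 14214570700, 1184525501458, 57880257270671,
     607904353779713, 127829775979950851, 2396777097380012429, 1255856912389383680646,
     70856540066363019374859, 5214838164865643190174213, 197117496400250690165280904,
     13852241512373653253557604804, 803678826157253713888580731074,
     20920164560691967146862959157575]
    [8, 14]
    [0, 16, 653, 70474, 3982030, 172536591, 14230787020, 771251831881, 57243475935627,
     2006201775435908, 307696268575273222, 9332039460835296131, 1201619231053285450240,
     10772917692958987313733, 3670548415942950649131010, 80744147596760587058553153,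
     17529784256506140170766536775, 716887925797021309674851419272,
     25369243714020433105471935090898, 2601468075285164380771832671838673]
    rfl (by decide +kernel) (by decide +kernel)

theorem hasBicoloredDoubling_21 : HasBicoloredDoubling 21 :=
  hasBicoloredDoubling_of_check [9, 17]
    [0, 13, 654, 78985, 2659596, 255394899, 21797086161, 1119028049108, 40282738439186,
     2006275894297347, 91814178436681872, 23167097657888899983, 1262468514269022179908,
     9834730962986607362049, 2144048113322166263743170, 389288303248795007783563659,
     21394450176404792229399122442, 1208425679404619098454490956102,
     21403057942393850379040454893768, 3611232207007412064009346555064773,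
     273904531173107509402904639796482311]
    [8, 16]
    [0, 15, 652, 82701, 4515082, 273191635, 13189854097, 708890129488, 36083161432078,
     867047599272011, 149797949752783045, 1194361004977045824, 1328512658631679550281,
     24222953480929270616518, 6082927170579822280184835, 102461426649482683331150404,
     16290352247963743839964389652, 93177109011849261390541693320, 577116451211226709000446562817,
     1374871435312884245969862886700167, 128854165760559224071348499974001858,
     21375134812573760177941961609728491666]
    rfl (by decide +kernel) (by decide +kernel)

theorem hasBicoloredDoubling_25 : HasBicoloredDoubling 25 :=
  hasBicoloredDoubling_of_check [12, 20, 24]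
    [0, 15, 1549, 58130, 3482645, 408249623, 20742468688, 1597934228884, 106461891728726,
     5696450933343448, 237641109895988686, 25747159900178445132, 9262234426853855435,
     23696177579154824233666, 2216191942567033393656970, 84436300222319750723690497,
     12849777036663526953639555334, 264132856912050754656309117331,
     122434771483933112725362545017731, 2596331864527379301963083473027665,
     319063639392475955124165551948865863, 32362690666152958226029353113094484484,
     1635391522421112478845116498199887499720, 132053740262537186847021932832986172273285,
     7792834674252970499083156690226176540020873]
    -- The vertices end at 25, so the bound 26 leaves the fourth color unused on `X`; only `V` must
    -- show all colors.
    [8, 20, 26]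
    [0, 21, 1303, 62872, 5595982, 340624854, 17571075596, 1534785819796, 26401486459346,
     616772523033619, 433766632744608269, 10448676805942772497, 160635294345554113609,
     48995815849610642981199, 6385160701695840994997446, 194062404011376980657214147,
     5126856530835312837258191819, 184919734854913010933626618442,
     32331306334023437555952959923088, 16823820135493749345722881822786,
     441133391981755857470427805618827652, 12299351217757596437899865884162003079,
     268864028403183003408828023378123702277, 131019744014386096291755150815947283542209,
     2484756741990665913899054347236866238734592, 202454429180592060636509278067251624407736968]
    rfl (by decide +kernel) (by decide +kernel)

theorem hasBicoloredDoubling_31 : HasBicoloredDoubling 31 :=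
  hasBicoloredDoubling_of_check [14, 23]
    [0, 29, 1688, 87950, 6349842, 426866202, 29383529427, 986186364497, 67515196715925,
     6871763245974937, 494684727901251343, 19985089776363304414, 1646720781313036321947,
     115279725383100484409046, 2820586954949544000897539, 567000524146725476218483082,
     32672136805082588593980227860, 1939061423714508672770223138055,
     46304123517294502937642663756548, 7490102261540149705483924465288518,
     83730874124361064688934740190897232, 9333929887177570485005029293362263240,
     378110862749300357674760909569007067725, 89614273103819006327747323933794920583900,
     2539733653430030690689710286653578583998786, 227620443959896949723856053007975252754031049,
     17267823552260357096346637038514773358470762629,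
     1578987355523631324674002466104680760018203341644,
     123524318382272519908910590239892612769718448984727,
     6454294059695186313042440975428222155982733480349697,
     437131032578414209380262424807122638613464947175559371]
    [12, 20]
    [0, 15, 1936, 91025, 4039762, 457295060, 18764326163, 1050530108441, 98772777244124,
     7442620352100061, 350807034253121046, 18758140429132215886, 312679882471827321419,
     6356113438658025039172, 109579444183513912358279, 178072111725220940647502528,
     36405592662475277152179228746, 242876044906869814691188523021,
     47545642283751157214374351655240, 456520295615690558933308748674197,
     359664917059502636712515029697347713, 5925472721184413197768726150856069979,
     1886512746957363478502799181885305284439, 55729803398860525093343502753835239698970,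
     7073309228761698348585016509329954501034782, 50639467682583696542053322533328262118277580,
     20275564487304360431954990186142550750483738904,
     1032264587898595985175939662696306685983119757513,
     117655482113024874096165161090683146450634091544962,
     3748767582426880801558214116709413559306667278304899,
     485353464418072558420643027272509781619246631062120198,
     34129122346062776448844195491468457702425308340983440005]
    rfl (by decide +kernel) (by decide +kernel)

theorem hasBicoloredDoubling_33 : HasBicoloredDoubling 33 :=
  hasBicoloredDoubling_of_check [16, 26, 31]
    [0, 21, 1938, 82973, 6150096, 325916506, 24065996243, 1133340903124, 116367228744864,
     7979929337464094, 475205787404843036, 33893890577475929179, 1204181024785612235992,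
     129075765125681485555103, 8889890994012606589138710, 530866256972116291198453393,
     2868229363969891868627759300, 633904499004675214036865929935,
     143018037686878847063509291237890, 9565309082963556866696097207714566,
     645291067645546628231790978681811527, 20093704307966137471616240720852127745,
     2339512175617009359084424239328233571150, 153482519096428475240860807530333709853081,
     10614011085834970148443784473983365364364876, 22464258195486411157829530867495204625405463,
     24626743737651570407446979818831234213499163589,
     1852956839067207804966770779601130929465259762123,
     184191027993447596011683612463471457595228467786634,
     9490027313544038811512528615740385624045758904811843,
     390796709389473962071287536626712394099645731513569417,
     40621400184072882445264515619549473810200475998626275597,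
     2886441311698322859859402669564156027624687725772632003208]
    [16, 26, 30]
    [0, 32, 2004, 103958, 5572060, 441529745, 27170002071, 1817265644827, 72041104238430,
     5164439861593885, 547575924165538834, 23409532502178076378, 1657204286165299869336,
     133426838539465092355987, 6187879906755970256979551, 472465499016293173601084501,
     27392471148316539417958646348, 2233305878563057350484351811982,
     138037877425932613287397168530374, 9244186118778954029682252344775880,
     550461911861619760130045300237141337, 36495080133579423524627449590127321232,
     2384790621978357686223711637587628405515, 147259156134070314864701373037275151135373,
     10978737927573407855012750496528764713849026, 188304559236941976700743549116212280058454721,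
     30560173261141886530557134905090118069624546183,
     1589003466094992496300955414587687382377741947333,
     1764487038399742529580213845831135627942988997123,
     6176239403338680818822237616626302000007061897764937,
     729005362203736705648570966895513514819313930245817156,
     28291090681821705465664438444056581412601020228977865034,
     2587511133632512381204488325324401833174614215142719123712,
     185018867401618354572997687436730000736639691558917377921039]
    rfl (by decide +kernel) (by decide +kernel)

theorem hasBicoloredDoubling_37 : HasBicoloredDoubling 37 :=
  hasBicoloredDoubling_of_check [16, 28]
    [0, 21, 1883, 128921, 7481374, 310514980, 27234772957, 1678785468567, 72673369409233,
     9162263064033372, 658499461129766354, 28198305986638366371, 2316695965467258459553,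
     96181888105297415365858, 8554675879645254206433496, 568640385871297057094202394,
     1303846937862746786886099923, 2706549783802468524692139722248,
     33210257126506356926614527600202, 2423758083639185189862646902461264,
     86141724766891099280707928343548246, 47980789059494260827880836466076315649,
     765853468363296323495831005585497490196, 193321018512161918858792197300868796707463,
     11512308155149231011382574061602952440538190, 92418142082176641901453421394861854862427267,
     12121331937026955794594312117131010837508285135,
     1294807783516359746746258799603294569369273106946,
     194604515039571704721852020133407472901621948659977,
     9479705745036785779260728403774954335495751303696518,
     529990504930782410666504285086310775134524983728197828,
     27712616272317235622187947163317965564764567578723496352,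
     38728532430836736843836551589950737298446852095410057503,
     127037832458971905385264289670244830101378709536087414690380,
     7307569057884156405495889802084417425350338814873637177016781,
     85584007081335122636013001884591568602149001541146723658367883,
     41427360841138113561787662103589574719626010469173824142175143685]
    [14, 22]
    [0, 20, 1941, 91352, 6911714, 592557456, 27171850258, 2423794255703, 137739893605850,
     9677249926476960, 419496364729320787, 34972220254452520605, 2012142291643688916511,
     91519384567142799443729, 2721220110054096828920731, 232435422524425241055765570,
     9968269578268739168342188505, 335601741432699732061781791756,
     55787865860098661443348732630602, 3934989465651320901843840791753359,
     291129667395813697788436956884525206, 11995575287619160730125334143206269440,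
     1474685829131733741397457643627837976974, 110721335039077256906050558969456185451292,
     9497919379405052752403252264180265264619809, 410192806958707852284855341439297548783858504,
     37602907657111434331683685774219935374116505545,
     1848312698583602977017866588014909060181857687620,
     157962450463461536511489478244091913269222030754759,
     8607628414053467336859473331965399231573475676174534,
     434050218328445452559108912297786498437117290482294787,
     25146354110676031405368850803552734813579042047363385605,
     1701119877813724805528161136972785192672262425668066492993,
     82502314363841757117364146503814870706254004674012666169507,
     8205580499263901266030824544897662473507670711368190678012235,
     644947689591383039721566371593648504317911810557617370554036324,
     28596667831912474098787440025169954699524131479981667668635816670,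
     2656416539633283084875456283679522842566801368896981051299229716685]
    rfl (by decide +kernel) (by decide +kernel)

theorem hasBicoloredDoubling_45 : HasBicoloredDoubling 45 :=
  hasBicoloredDoubling_of_check [22, 35, 41]
    [0, 35, 1754, 170391, 9005727, 629590566, 24103487323, 1680850204261, 99195162314795,
     8324028308813785, 441245600301312610, 29626774666199837032, 2395295371410456544940,
     172194994496533307480864, 10179536708018542552905252, 608889717415933281073522461,
     40342603441979192691277575576, 3142577443519734305451645765537,
     211109153174093228792771331365610, 14407774326126885924521364579854633,
     610291017244406474618809750676936807, 43375268844742518204404354943361894878,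
     1207565716289193041321187360933217584156, 202906758807725020441071736694074448603267,
     5461300793139204344171512113221895772226448, 816624344362813328665155984722341655709041097,
     50860924857188373083261028729402196543695487746,
     3306434137513347160980904224092518203683717255302,
     255268525013585981305407703602710565179604282409942,
     13730043671952303966105729711220569156441316388368783,
     901046877120062763400221680105890282412729499998004309,
     62886399101132308478038198439619309560050152861319680580,
     3983976048507597355698551691548194869775590077322059342349,
     47721423878843622515282827601484993892537730907435166934289,
     17946877859646841701287562618507113409309638347665756012983754,
     1040633179203996872250247812656174466686104335696466178280062977,
     68252027872203114027493392408722910747685924712382207238258906318,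
     3545048516473297595586106323817584999367209582602565940833276973767,
     179841190908787035631673597087246332934814425169565205962752298119365,
     18326516482600150211401289908791251227225867796620134388096665914479956,
     376873467253049984535206652040532597248997434254389232884464552376340811,
     68372443749729954471761768274272612870213963301372144665345024467283751571,
     2677839432185419240071446659649954624838999753389954771781581576836131402002,
     293739306573230555468877893731811100748484142102603085236465830399532259112072,
     14160059480135045519671481514562527100197263488037956574920822924479136414323532]
    [22, 34, 42]
    [0, 44, 1959, 100961, 9872867, 745162857, 45507529183, 1761546737888, 187575911151396,
     7469968827242332, 636891744940747097, 38848804676052817878, 2019422699922159969899,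
     148578913220767061785306, 8285641595044962464864541, 549355143895685258927835547,
     55139595799556342510094776023, 3369161621195143345430720021928,
     149150142392912400593379583507110, 13424543238368908177772242290726552,
     901367447278430651374075599535040549, 45952996004916106453306179526713329194,
     2593390727426063561089724696657710040418, 192267911557642821569110921002603281441232,
     14134159101030941041577745420014348356595989, 965423884389923364112062775858836910067787913,
     59377542975660845077010460660603655873052876814,
     3563361900293264502895285774786434188307911693190,
     243757618917320038590064765870815475807692099224832,
     14478663141462562866779419339831829676117183999558856,
     122580033795200027802814009934965645874519898415543390,
     67802299886967926903146024413495383392838306475695174405,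
     4224564747421174219341713395662089184636330730851362431554,
     259083927942658829644161879887132030068906146213040573645316,
     8991302369701681542794155980985709876487508725905273880138067,
     710069422308762324577117348065487942024735742679093440593560387,
     35650921573877584144233947805409130597858949449874496717096524289,
     2559521422836873924669045001715417160544017363837692275369661473940,
     299650041520183359962151018088162410666355012168276264191125100499148,
     13653176967331184664624219855963651483015895552390386443788141886186123,
     951789711155409564870550419765830980661779108123835952179487807295722506,
     78469691594454712120005584533993462807763484136180742234737760532066521487,
     4476488449954209814107454157832384317676813607699836426838673072333704213447,
     185064218354112166737916325964184615928089953032205853715889014799264428077137,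
     15115566704077356697769595626342898591532242343507288187764815687679712526942930,
     1170648485788215112055530532975958095308319614112826539681644053263912391074967693]
    rfl (by decide +kernel) (by decide +kernel)

theorem hasBicoloredDoubling_49 : HasBicoloredDoubling 49 :=
  hasBicoloredDoubling_of_check [21, 39, 47]
    [0, 32, 2965, 125078, 10353507, 379242340, 40227456609, 2984555956720, 208887525522156,
     10281432746722791, 566712921077192619, 54716908662380996130, 1591727397882238167150,
     176772493768399376717807, 10430061972758178167946282, 491643762528060416646282217,
     40168542330627628161527364141, 3769035220029926237526280047389,
     129735568396874832086444697332008, 12451241005390952515148621983709861,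
     907878567911027441124003013782039135, 29461444397756326554080865877573240450,
     1729875073751340197255270452270825785091, 32958563924562566236397074882153539760732,
     4405329052729045306148569037823437636522714, 447657054174477638301689885259341965496734118,
     17143801412051002687940307820532685983364547928,
     1657933805528995347700470893266331074468449388766,
     115436194808582706032795663345458022318337422554519,
     16550376715363955942513502679558151657010845618680145,
     290336678914743147080653660227625802060474994989216411,
     22390747142139626473756395590554394479903905976538645332,
     4127995888780677719392023044019774049940515359286280953857,
     277295457736618871555211421597074730606962114739419746444038,
     1658890043710455120543118870742239061636851732100172554248395,
     1061822735535191319956723360869081382808188585510909192568952516,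
     5133851691906085858895693812594365034613953776969564095458862213,
     4123113481789662864914843326918523506925689636705499749524131907987,
     7180355456714625708180375194422022267255928552720117369647620507993,
     14912784249740225050737952498991829949867444112111612434351534082417097,
     897957201881905150339004295092851945151134705999333416406623883540075538,
     83329740329980623436125778033210672086720924010323475010033536033473615119,
     5440905645837222641700503438394846447096729216288472800427459465771360498894,
     212521210210189380149667787102253493473566284538608520014726113981509117215242,
     22575113451888372528636707575480364036463364017330568780850710123476080705688648,
     638897606878588919631658624759524725000677680592130945475194228655981949715648784,
     89612585419489383700669482586885880338243771593915150421989099980003271703727968396,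
     5552287971662231214473334971929939816353658906863518600597868063354661748922270692301,
     36014658192463564823965632947824335128655346116065419483132115749543289602821490545543]
    [20, 40, 44]
    [0, 47, 2849, 177582, 9083735, 514947178, 49029208804, 2789236189654, 208945571628585,
     7730092552342424, 463208752133318312, 51545249189605341611, 1898383706258185554087,
     149519662838969576315949, 10154754696389099226262111, 862170603096527657826621141,
     51387953962701025412562479781, 2503997802392704664065687009068,
     120083595613972244460826475788832, 11919048411007779824399102518678896,
     507355298195806010148943918248125454, 57928510477210107899111300097541673289,
     3550394036010020052999120715687903470228, 243524029568070824454758695171747667654553,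
     4759539249548169424327378474270884505186906, 37982255560039918699294541195025444743282951,
     63705947851139507894085742203637319591528908365,
     3806918767106074762298513804973862590593076078914,
     80406454010006313372685317640784488923285621311503,
     15981405759997279920006548057361115231284639437199203,
     145403618617471777368476732072707065445733936337605770,
     64396522296964555777611379060904040727469257940013253340,
     1005787457204065420203546797393480734858223853912418474274,
     270117297416032455566407462957133668773089260571226855794880,
     7116188459057939034892507334206941347222730974167434207228766,
     365469464846502128400475278337421733004572614977831167497359590,
     66918582120207835469828850050750792158137370199903966016294412381,
     2184716237677543390016515687854335734979960428645036006250167449563,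
     25249694425162459885071297436006968318994350422447896739670098724296,
     7351290238607521041200976048940194596111086728197570887192541718672262,
     789161500530945007678500072140229506193078577639735784276812311718813712,
     85512782613036777511159364503790222466243299349729142310350284436659048588,
     5350964729023785848750320017834529004250147364299783028659893270546933686795,
     347460235472570686474453655842273438010125079638281306386802329704855025550610,
     21165941773657965182546119197867696364870876055484937680302810232655209525986387,
     1175388392211504243320212086233896795296253378695692431548159517848840119883215237,
     84027849376559811358366994370533293870329059049553556272556839917098626199094904003,
     5483931747460412708122608026981878705961137787108143838033696684190617071560614486977,
     346968876257565973688357344853356572568733885158437393117862100310928125746364785918724,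
     7791034989335944130952409514647157512248015240156993007742883006424472097813908003500497]
    rfl (by decide +kernel) (by decide +kernel)

/-! ### Assembling the orders. -/

theorem theorem10 :
    ∀ w ∈ ({27, 39, 43, 55, 79, 87, 91, 99, 103, 111, 127, 135, 151, 159, 175} : Finset ℕ),
      ∃ T : SteinerTripleSystem (Fin w), T.HasExtendedBicoloring ∧
        ∃ m n : ℕ, T.IsLowerChromaticNumber m ∧ T.IsUpperChromaticNumber n ∧ m ≠ n := by
  have key {v : ℕ} (h : HasBicoloredDoubling v) :
      ∃ T : SteinerTripleSystem (Fin (2 * v + 1)), T.HasExtendedBicoloring ∧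
        ∃ m n : ℕ, T.IsLowerChromaticNumber m ∧ T.IsUpperChromaticNumber n ∧ m ≠ n := by
    obtain ⟨k, ⟨D⟩⟩ := h
    exact D.exists_hasExtendedBicoloring
  intro w hw
  simp only [Finset.mem_insert, Finset.mem_singleton] at hw
  rcases hw with rfl | rfl | rfl | rfl | rfl | rfl | rfl | rfl | rfl | rfl | rfl | rfl | rfl |
    rfl | rfl
  -- Each `w` is `2 * v + 1` with `v` a starting order or obtained from one by one or two doublings,
  -- such as 13, 27, 55 for `w` = 27, 55, 111.
  · exact key hasBicoloredDoubling_13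
  · exact key hasBicoloredDoubling_19
  · exact key hasBicoloredDoubling_21
  · exact key hasBicoloredDoubling_13.double
  · exact key hasBicoloredDoubling_19.double
  · exact key hasBicoloredDoubling_21.double
  · exact key hasBicoloredDoubling_45
  · exact key hasBicoloredDoubling_49
  · exact key hasBicoloredDoubling_25.double
  · exact key hasBicoloredDoubling_13.double.double
  · exact key hasBicoloredDoubling_31.double
  · exact key hasBicoloredDoubling_33.double
  · exact key hasBicoloredDoubling_37.double
  · exact key hasBicoloredDoubling_19.double.double
  · exact key hasBicoloredDoubling_21.double.double
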